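/- **Syntax.** Let $PS=\{x_0,x_1,\dots\}$ be a countably infinite set of propositional statements. $\mathrm{QBF}$ is the closure of $PS$ under $\neg\alpha$, $\alpha\to\beta$ and $\forall x\,\alpha$ ($x\in PS$); put $\top:=x_0\to x_0$, $\bot:=\neg\top$, $\alpha\wedge\beta:=\neg(\alpha\to\neg\beta)$, $\alpha\vee\beta:=\neg\alpha\to\beta$, $\alpha\leftrightarrow\beta:=(\alpha\to\beta)\wedge(\beta\to\alpha)$, and let $\alpha[x/\gamma]$ be $\alpha$ with the free occurrences of $x$ replaced by $\gamma$. The formulas of quantified propositional team logic $\mathrm{QPTL}$ are the closure of $\mathrm{QBF}$ under $\sim\varphi$, $\varphi\rightarrowtriangle\psi$, $\varphi\multimap\psi$, $!x\,\varphi$ and $\forall x\,\varphi$, where for $\alpha\in\mathrm{QBF}$ the formula $\forall x\,\alpha$ is the one already in $\mathrm{QBF}$. Abbreviate $\varphi\otimes\psi:=\;\sim(\varphi\multimap\sim\psi)$, $\exists x\,\varphi:=\;\sim\,!x\sim\varphi$, and $\varphi\leftrightarrowtriangle\psi:=\;\sim((\varphi\rightarrowtriangle\psi)\rightarrowtriangle\sim(\psi\rightarrowtriangle\varphi))$.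 **Semantics.** A team is a (possibly empty) set $T$ of assignments $s:PS\to\{0,1\}$. For $\alpha\in\mathrm{QBF}$, $T\vDash\alpha$ iff every $s\in T$ satisfies $\alpha$ classically. Moreover $T\vDash\sim\varphi$ iff $T\nvDash\varphi$; $T\vDash\varphi\rightarrowtriangle\psi$ iff $T\nvDash\varphi$ or $T\vDash\psi$; $T\vDash\varphi\multimap\psi$ iff for all $S,U$ with $S\cup U=T$, $S\vDash\varphi$ implies $U\vDash\psi$. For $f$ assigning a non-empty subset of $\{0,1\}$ to each $s\in T$ put $T[f/x]:=\{s[x\mapsto a]: s\in T,\ a\in f(s)\}$; then $T\vDash\,!x\,\varphi$ iff $T[f/x]\vDash\varphi$ for all such $f$, and $T\vDash\forall x\,\varphi$ iff $T[f/x]\vDash\varphi$ for the constant function $f(s)=\{0,1\}$ (this agrees with the classical clause if $\varphi\in\mathrm{QBF}$). For a set $\Phi$ of formulas, $\Phi\vDash\varphi$ means that every team satisfying all members of $\Phi$ satisfies $\varphi$. **Proof system $\mathsf{H}^0\mathsf{XLSQ}$.** In the following, $\alpha,\beta,\gamma$ range over $\mathrm{QBF}$, $\varphi,\psi,\vartheta$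 over $\mathrm{QPTL}$, and $x$ over $PS$; implications associate to the right. Axioms: - $\mathsf{H}^0$: $\alpha\to(\beta\to\alpha)$; $(\alpha\to(\beta\to\gamma))\to(\alpha\to\beta)\to(\alpha\to\gamma)$; $(\neg\alpha\to\neg\beta)\to(\beta\to\alpha)$. - $\mathsf{X}$: $\forall x\,\alpha\leftrightarrow(\alpha[x/\top]\wedge\alpha[x/\bot])$. - $\mathsf{L}$: $\varphi\rightarrowtriangle(\psi\rightarrowtriangle\varphi)$; $(\varphi\rightarrowtriangle(\psi\rightarrowtriangle\vartheta))\rightarrowtriangle(\varphi\rightarrowtriangle\psi)\rightarrowtriangle(\varphi\rightarrowtriangle\vartheta)$; $(\sim\varphi\rightarrowtriangle\sim\psi)\rightarrowtriangle(\psi\rightarrowtriangle\varphi)$; $(\alpha\to\beta)\rightarrowtriangle(\alpha\rightarrowtriangle\beta)$. - $\mathsf{S}$: $(\alpha\otimes\beta)\leftrightarrowtriangle(\alpha\vee\beta)$; $\alpha\rightarrowtriangle(\varphi\multimap\alpha)$; $\varphi\rightarrowtriangle(\varphi\multimap\psi)\rightarrowtriangle(\vartheta\multimap\psi)$; $(\varphi\multimap(\psi\multimap\vartheta))\rightarrowtriangle(\psi\multimap(\varphi\multimap\vartheta))$;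 $(\varphi\multimap\sim\psi)\rightarrowtriangle(\psi\multimap\sim\varphi)$; $(\varphi\multimap(\psi\rightarrowtriangle\vartheta))\rightarrowtriangle(\varphi\multimap\psi)\rightarrowtriangle(\varphi\multimap\vartheta)$. - $\mathsf{Q}$: $\forall x\sim\varphi\leftrightarrowtriangle\;\sim\forall x\,\varphi$; $\exists x\,\alpha\leftrightarrowtriangle\neg\forall x\neg\alpha$; $\exists x(\varphi\otimes\psi)\leftrightarrowtriangle(\exists x\,\varphi\otimes\exists x\,\psi)$; $\forall x\,\alpha\rightarrowtriangle\,!x\,\alpha$; $!x\,\varphi\rightarrowtriangle\forall x\,\varphi$; $\forall x(\varphi\rightarrowtriangle\psi)\rightarrowtriangle(\forall x\,\varphi\rightarrowtriangle\forall x\,\psi)$; $!x(\varphi\rightarrowtriangle\psi)\rightarrowtriangle(!x\,\varphi\rightarrowtriangle\,!x\,\psi)$. Rules: from $\alpha$ and $\alpha\to\beta$ infer $\beta$; from $\varphi$ and $\varphi\rightarrowtriangle\psi$ infer $\psi$; if $\varphi$ is a theorem (derivable without premises), infer $\psi\multimap\varphi$ and $!x\,\varphi$. Write $\Phi\vdash\varphi$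 if $\varphi$ is derivable from the premises $\Phi$. **Theorem.** The proof system $\mathsf{H}^0\mathsf{XLSQ}$ is sound and complete for $\mathrm{QPTL}$: for every (possibly infinite) set $\Phi$ of $\mathrm{QPTL}$ formulas and every $\mathrm{QPTL}$ formula $\varphi$, $\Phi\vdash\varphi$ if and only if $\Phi\vDash\varphi$. -/

import Mathlib

namespace TeamLogic

/-! ## Quantified Boolean formulas -/

/-- Quantified Boolean formulas over the propositional statements `x₀, x₁, …`, which are
identified with the natural numbers. -/
inductive QBF : Type
  | var (x : ℕ) : QBF
  | neg (α : QBF) : QBF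
  | imp (α β : QBF) : QBF
  | all (x : ℕ) (α : QBF) : QBF

namespace QBF

/-- `⊤ := α → α` for the fixed formula `α := x₀`. -/
def top : QBF := imp (var 0) (var 0)

/-- `⊥ := ¬ ⊤`. -/
def bot : QBF := neg top

def and (α β : QBF) : QBF := neg (imp α (neg β))

def or (α β : QBF) : QBF := imp (neg α) β

def iff (α β : QBF) : QBF := and (imp α β) (imp β α)

/-- `α[x/γ]` is `α.subst x γ`: the free occurrences of `x` in `α` are replaced by `γ`. -/
def subst : QBF → ℕ → QBF → QBF
  | var y, x, γ => if y = x then γ else var y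
  | neg α, x, γ => neg (α.subst x γ)
  | imp α β, x, γ => imp (α.subst x γ) (β.subst x γ)
  | all y α, x, γ => if y = x then all y α else all y (α.subst x γ)

end QBF

/-- A propositional assignment. -/
abbrev Assignment : Type := ℕ → Bool

/-- Classical truth of quantified Boolean formulas. -/
def QBF.Holds : QBF → Assignment → Prop
  | .var x, s => s x = true
  | .neg α, s => ¬ α.Holds s
  | .imp α β, s => α.Holds s → β.Holds s
  | .all x α, s => ∀ a : Bool, α.Holds (Function.update s x a)

theorem QBF.holds_subst (x : ℕ) (γ : QBF) (a : Bool) (hγ : ∀ s, γ.Holds s ↔ a = true)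
    (α : QBF) (s : Assignment) :
    (α.subst x γ).Holds s ↔ α.Holds (Function.update s x a) := by
  induction α generalizing s with
  | var y =>
    by_cases h : y = x
    · subst h
      simp [QBF.subst, QBF.Holds, hγ]
    · simp [QBF.subst, QBF.Holds, h]
  | neg α ih => simp [QBF.subst, QBF.Holds, ih]
  | imp α β ihα ihβ => simp [QBF.subst, QBF.Holds, ihα, ihβ]
  | all y α ih =>
    by_cases h : y = x
    · subst h
      simp [QBF.subst, QBF.Holds]
    · simp only [QBF.subst, h, if_false, QBF.Holds, ih]
      exact forall_congr' fun b => by rw [Function.update_comm h]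

/-- The truth clause of `∀ x α` in terms of substitution. -/
theorem QBF.holds_all_iff (x : ℕ) (α : QBF) (s : Assignment) :
    (QBF.all x α).Holds s ↔ (α.subst x .top).Holds s ∧ (α.subst x .bot).Holds s := by
  rw [QBF.holds_subst x .top true (by simp [QBF.top, QBF.Holds]),
    QBF.holds_subst x .bot false (by simp [QBF.bot, QBF.top, QBF.Holds])]
  simp [QBF.Holds, and_comm]

/-! ## Formulas of quantified propositional team logic -/

/-- The formulas of the closure of `QBF` under the team-logical connectives and quantifiers,
sorted by whether they are classical (`Form true`) or not (`Form false`). A word `∀ x α` with `α`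
classical is one single formula, and it is classical; hence the constructor `all` only takes
non-classical formulas (see `QPTL.all`). -/
inductive Form : Bool → Type
  | flat (α : QBF) : Form true
  | sneg {k : Bool} (φ : Form k) : Form false
  | mimp {k l : Bool} (φ : Form k) (ψ : Form l) : Form false
  | limp {k l : Bool} (φ : Form k) (ψ : Form l) : Form false
  | shriek {k : Bool} (x : ℕ) (φ : Form k) : Form false
  | all (x : ℕ) (φ : Form false) : Form false

/-- The formulas of quantified propositional team logic. -/
abbrev QPTL : Type := Σ k : Bool, Form k

namespace QPTL

/-- Classical formulas are formulas. -/
def flat (α : QBF) : QPTL := ⟨true, .flat α⟩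

/-- Strong negation `∼ φ`. -/
def sneg (φ : QPTL) : QPTL := ⟨false, .sneg φ.2⟩

/-- Material implication. -/
def mimp (φ ψ : QPTL) : QPTL := ⟨false, .mimp φ.2 ψ.2⟩

/-- Linear implication. -/
def limp (φ ψ : QPTL) : QPTL := ⟨false, .limp φ.2 ψ.2⟩

/-- The quantifier `! x φ` over all supplementing teams. -/
def shriek (x : ℕ) (φ : QPTL) : QPTL := ⟨false, .shriek x φ.2⟩

/-- The quantifier `∀ x φ`. If `φ` is a classical formula `α`, this is the classical formula
`∀ x α`. -/
def all (x : ℕ) : QPTL → QPTL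
  | ⟨true, .flat α⟩ => flat (.all x α)
  | ⟨false, φ⟩ => ⟨false, .all x φ⟩

end QPTL

prefix:max "∼" => QPTL.sneg
infixr:56 " ⊸ " => QPTL.limp
infixr:55 " ⇾ " => QPTL.mimp

namespace QPTL

def conj (φ ψ : QPTL) : QPTL := ∼(φ ⇾ ∼ψ)

def biimp (φ ψ : QPTL) : QPTL := conj (φ ⇾ ψ) (ψ ⇾ φ)

/-- Splitting disjunction. -/
def tensor (φ ψ : QPTL) : QPTL := ∼(φ ⊸ ∼ψ)

/-- `∃ x φ := ∼ ! x ∼ φ`. -/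
def ex (x : ℕ) (φ : QPTL) : QPTL := ∼(shriek x ∼φ)

end QPTL

infixl:57 " ⊗ᵗ " => QPTL.tensor
infix:54 " ⇿ " => QPTL.biimp

/-! ## Team semantics -/

abbrev Team : Type := Set Assignment

/-- The supplementing team `T[f/x]`. -/
def Team.supplement (T : Team) (f : Assignment → Set Bool) (x : ℕ) : Team :=
  {u | ∃ s ∈ T, ∃ a ∈ f s, u = Function.update s x a}

/-- The duplicating team `T[{0,1}/x]`. -/
def Team.duplicate (T : Team) (x : ℕ) : Team := T.supplement (fun _ => Set.univ) x

/-- Team semantics (lax). -/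
def Form.Sat : {k : Bool} → Form k → Team → Prop
  | _, .flat α, T => ∀ s ∈ T, α.Holds s
  | _, .sneg φ, T => ¬ φ.Sat T
  | _, .mimp φ ψ, T => φ.Sat T → ψ.Sat T
  | _, .limp φ ψ, T => ∀ S U : Team, S ∪ U = T → φ.Sat S → ψ.Sat U
  | _, .shriek x φ, T =>
      ∀ f : Assignment → Set Bool, (∀ s ∈ T, (f s).Nonempty) → φ.Sat (T.supplement f x)
  | _, .all x φ, T => φ.Sat (T.duplicate x)

def QPTL.Sat (φ : QPTL) (T : Team) : Prop := φ.2.Sat T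

/-- On classical and non-classical formulas alike, `∀ x φ` has the duplicating-team semantics. -/
theorem QPTL.sat_all (x : ℕ) (φ : QPTL) (T : Team) :
    (QPTL.all x φ).Sat T ↔ φ.Sat (T.duplicate x) := by
  obtain ⟨k, φ⟩ := φ
  cases k with
  | false => exact Iff.rfl
  | true =>
    cases φ with
    | flat α =>
      constructor
      · rintro h u ⟨s, hs, a, -, rfl⟩
        exact h s hs a
      · intro h s hs a
        exact h _ ⟨s, hs, a, trivial, rfl⟩

/-- Semantical consequence `Φ ⊨ φ`. -/
def Entails (Φ : Set QPTL) (φ : QPTL) : Prop :=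
  ∀ T : Team, (∀ ψ ∈ Φ, ψ.Sat T) → φ.Sat T

/-! ## The proof system -/

/-- The axioms of `H⁰`. -/
inductive AxiomH : QBF → Prop
  | a1 (α β : QBF) : AxiomH (.imp α (.imp β α))
  | a2 (α β γ : QBF) :
      AxiomH (.imp (.imp α (.imp β γ)) (.imp (.imp α β) (.imp α γ)))
  | a3 (α β : QBF) : AxiomH (.imp (.imp (.neg α) (.neg β)) (.imp β α))

/-- The quantifier expansion axiom `X`. -/
inductive AxiomX : QBF → Prop
  | x (x : ℕ) (α : QBF) :
      AxiomX (.iff (.all x α) (.and (α.subst x .top) (α.subst x .bot)))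

/-- The axioms of `L`. -/
inductive AxiomL : QPTL → Prop
  | l1 (φ ψ : QPTL) : AxiomL (φ ⇾ (ψ ⇾ φ))
  | l2 (φ ψ θ : QPTL) : AxiomL ((φ ⇾ (ψ ⇾ θ)) ⇾ ((φ ⇾ ψ) ⇾ (φ ⇾ θ)))
  | l3 (φ ψ : QPTL) : AxiomL ((∼φ ⇾ ∼ψ) ⇾ (ψ ⇾ φ))
  | l4 (α β : QBF) : AxiomL (.flat (.imp α β) ⇾ (.flat α ⇾ .flat β))

/-- The axioms of `S`. -/
inductive AxiomS : QPTL → Prop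
  | flatTensor (α β : QBF) : AxiomS ((.flat α ⊗ᵗ .flat β) ⇿ .flat (.or α β))
  | flatLimp (α : QBF) (φ : QPTL) : AxiomS (.flat α ⇾ (φ ⊸ .flat α))
  | lax (φ ψ θ : QPTL) : AxiomS (φ ⇾ ((φ ⊸ ψ) ⇾ (θ ⊸ ψ)))
  | exchange (φ ψ θ : QPTL) : AxiomS ((φ ⊸ (ψ ⊸ θ)) ⇾ (ψ ⊸ (φ ⊸ θ)))
  | contra (φ ψ : QPTL) : AxiomS ((φ ⊸ ∼ψ) ⇾ (ψ ⊸ ∼φ))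
  | dis (φ ψ θ : QPTL) : AxiomS ((φ ⊸ (ψ ⇾ θ)) ⇾ ((φ ⊸ ψ) ⇾ (φ ⊸ θ)))

/-- The axioms of `Q`. -/
inductive AxiomQ : QPTL → Prop
  | linAll (x : ℕ) (φ : QPTL) : AxiomQ (.all x ∼φ ⇿ ∼(.all x φ))
  | flatEx (x : ℕ) (α : QBF) : AxiomQ (.ex x (.flat α) ⇿ .flat (.neg (.all x (.neg α))))
  | exTensor (x : ℕ) (φ ψ : QPTL) : AxiomQ (.ex x (φ ⊗ᵗ ψ) ⇿ (.ex x φ ⊗ᵗ .ex x ψ))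
  | elimAll (x : ℕ) (α : QBF) : AxiomQ (.all x (.flat α) ⇾ .shriek x (.flat α))
  | introAll (x : ℕ) (φ : QPTL) : AxiomQ (.shriek x φ ⇾ .all x φ)
  | disAll (x : ℕ) (φ ψ : QPTL) : AxiomQ (.all x (φ ⇾ ψ) ⇾ (.all x φ ⇾ .all x ψ))
  | disShriek (x : ℕ) (φ ψ : QPTL) :
      AxiomQ (.shriek x (φ ⇾ ψ) ⇾ (.shriek x φ ⇾ .shriek x ψ))

/-- `Derives Φ φ`: the formula `φ` is derivable from the premises `Φ` in the proof system
`H⁰XLSQ`. The rules `nec` and `gen` apply to theorems only, i.e. to formulas derived without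
premises. -/
inductive Derives : Set QPTL → QPTL → Prop
  | premise {Φ : Set QPTL} {φ : QPTL} (h : φ ∈ Φ) : Derives Φ φ
  | axH {Φ : Set QPTL} {α : QBF} (h : AxiomH α) : Derives Φ (.flat α)
  | axX {Φ : Set QPTL} {α : QBF} (h : AxiomX α) : Derives Φ (.flat α)
  | axL {Φ : Set QPTL} {φ : QPTL} (h : AxiomL φ) : Derives Φ φ
  | axS {Φ : Set QPTL} {φ : QPTL} (h : AxiomS φ) : Derives Φ φ
  | axQ {Φ : Set QPTL} {φ : QPTL} (h : AxiomQ φ) : Derives Φ φ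
  | mpImp {Φ : Set QPTL} {α β : QBF} (h₁ : Derives Φ (.flat α))
      (h₂ : Derives Φ (.flat (.imp α β))) : Derives Φ (.flat β)
  | mpMimp {Φ : Set QPTL} {φ ψ : QPTL} (h₁ : Derives Φ φ) (h₂ : Derives Φ (φ ⇾ ψ)) :
      Derives Φ ψ
  | nec {Φ : Set QPTL} {φ : QPTL} (ψ : QPTL) (h : Derives ∅ φ) : Derives Φ (ψ ⊸ φ)
  | gen {Φ : Set QPTL} {φ : QPTL} (x : ℕ) (h : Derives ∅ φ) : Derives Φ (.shriek x φ)

end TeamLogic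

namespace TeamLogic

/-! ## Lindenbaum's lemma for Hilbert systems -/

/-! Soundness is checked axiom by axiom; `nec` and `gen` are harmless because their premises are
theorems. Completeness is a canonical model argument. Seen from maximal consistent sets, `φ ⊸ ·` and
`! x` are normal boxes with duals `φ ⊗ᵗ ·` and `∃ x`, while `∀ x` is a self-dual, functional
modality. The model of a maximal consistent `Γ` is `teamOf Γ`, and the truth lemma `mem_iff_sat`
states that `Γ` consists of the formulas true there. For classical formulas this is strong
completeness of `H⁰X`.

In one direction of the truth lemma, a split or a quantifier in `Γ` yields maximal consistent sets
by Lindenbaum's lemma (`exists_split`, `exists_ex`), and the axioms relating these operators to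
classical formulas force their teams to be a division, respectively a supplement, of `teamOf Γ`.

The other direction starts from arbitrary teams, which need not be of the form `teamOf Δ`. A formula
sees only finitely many propositional statements, so by the induction hypothesis and compactness its
truth in `S` already follows from a single basic formula `α ∧ ∼β₁ ∧ ⋯ ∧ ∼βₙ` true in `S`
(`mem_basicTheory_of_sat`). For basic formulas, membership of the required `⊗ᵗ` or `∃ x` in `Γ` is
obtained directly from the axioms (`basic_tensor`, `ex_basic`): laxity lets the conjuncts `∼β` be
added one at a time. -/

/-- Derivability in classical propositional logic with connectives `imp` and `neg`. -/
inductive Hilbert {F : Type} (imp : F → F → F) (neg : F → F) (Δ : Set F) : F → Prop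
  | prem {φ : F} (h : φ ∈ Δ) : Hilbert imp neg Δ φ
  | a1 (φ ψ : F) : Hilbert imp neg Δ (imp φ (imp ψ φ))
  | a2 (φ ψ θ : F) :
      Hilbert imp neg Δ (imp (imp φ (imp ψ θ)) (imp (imp φ ψ) (imp φ θ)))
  | a3 (φ ψ : F) : Hilbert imp neg Δ (imp (imp (neg φ) (neg ψ)) (imp ψ φ))
  | mp {φ ψ : F} (h₁ : Hilbert imp neg Δ φ) (h₂ : Hilbert imp neg Δ (imp φ ψ)) :
      Hilbert imp neg Δ ψ

namespace Hilbert

variable {F : Type} {imp : F → F → F} {neg : F → F} {Δ Δ' : Set F} {φ ψ : F}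

theorem mono (h : Δ ⊆ Δ') (d : Hilbert imp neg Δ φ) : Hilbert imp neg Δ' φ := by
  induction d with
  | prem hφ => exact prem (h hφ)
  | a1 => exact a1 _ _
  | a2 => exact a2 _ _ _
  | a3 => exact a3 _ _
  | mp _ _ ih₁ ih₂ => exact mp ih₁ ih₂

theorem weaken (h : Hilbert imp neg Δ φ) : Hilbert imp neg Δ (imp ψ φ) :=
  mp h (a1 _ _)

theorem deduction (d : Hilbert imp neg (insert ψ Δ) φ) : Hilbert imp neg Δ (imp ψ φ) := by
  induction d with
  | prem hφ =>
    rcases hφ with hφ | hφ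
    · rw [hφ]
      exact mp (a1 ψ ψ) (mp (a1 ψ (imp ψ ψ)) (a2 ψ (imp ψ ψ) ψ))
    · exact weaken (prem hφ)
  | a1 => exact weaken (a1 _ _)
  | a2 => exact weaken (a2 _ _ _)
  | a3 => exact weaken (a3 _ _)
  | mp _ _ ih₁ ih₂ => exact mp ih₁ (mp ih₂ (a2 _ _ _))

theorem exfalso (h : Hilbert imp neg Δ ψ) (h' : Hilbert imp neg Δ (neg ψ)) :
    Hilbert imp neg Δ φ :=
  mp h (mp (weaken h') (a3 _ _))

theorem hyp : Hilbert imp neg (insert φ Δ) φ := prem (Set.mem_insert _ _)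

theorem lift (h : Hilbert imp neg Δ φ) : Hilbert imp neg (insert ψ Δ) φ :=
  h.mono (Set.subset_insert _ _)

theorem clavius (h : Hilbert imp neg (insert (neg φ) Δ) φ) : Hilbert imp neg Δ φ := by
  have h₁ : Hilbert imp neg Δ (imp (neg φ) φ) := deduction h
  have h₂ : Hilbert imp neg Δ (imp (neg φ) (neg (imp (neg φ) φ))) :=
    deduction (exfalso h hyp)
  exact mp h₁ (mp h₂ (a3 _ _))

theorem by_cases (h : Hilbert imp neg (insert ψ Δ) φ)
    (h' : Hilbert imp neg (insert (neg ψ) Δ) φ) : Hilbert imp neg Δ φ := by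
  refine clavius (mp (clavius (φ := neg ψ) ?_) (lift (deduction h')))
  have hψ : Hilbert imp neg (insert (neg (neg ψ)) (insert (neg φ) Δ)) ψ :=
    clavius (exfalso hyp (lift hyp))
  exact exfalso (mp hψ (lift (lift (deduction h)))) (lift hyp)

theorem sUnion {c : Set (Set F)} (hc : IsChain (· ⊆ ·) c) (hne : c.Nonempty)
    (d : Hilbert imp neg (⋃₀ c) φ) : ∃ Γ ∈ c, Hilbert imp neg Γ φ := by
  induction d with
  | prem h =>
    obtain ⟨Γ, hΓ, h⟩ := h
    exact ⟨Γ, hΓ, prem h⟩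
  | a1 => exact hne.imp fun Γ hΓ => ⟨hΓ, a1 _ _⟩
  | a2 => exact hne.imp fun Γ hΓ => ⟨hΓ, a2 _ _ _⟩
  | a3 => exact hne.imp fun Γ hΓ => ⟨hΓ, a3 _ _⟩
  | mp _ _ ih₁ ih₂ =>
    obtain ⟨Γ₁, hΓ₁, d₁⟩ := ih₁
    obtain ⟨Γ₂, hΓ₂, d₂⟩ := ih₂
    rcases hc.total hΓ₁ hΓ₂ with h | h
    · exact ⟨Γ₂, hΓ₂, mp (d₁.mono h) d₂⟩
    · exact ⟨Γ₁, hΓ₁, mp d₁ (d₂.mono h)⟩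

/-- An underivable formula is avoided by some complete and consistent extension. -/
theorem exists_complete (h : ¬ Hilbert imp neg Δ φ) :
    ∃ Γ, Δ ⊆ Γ ∧ φ ∉ Γ ∧ (∀ ψ θ, imp ψ θ ∈ Γ ↔ (ψ ∈ Γ → θ ∈ Γ)) ∧
      ∀ ψ, neg ψ ∈ Γ ↔ ψ ∉ Γ := by
  obtain ⟨Γ, hΔ, hmax⟩ := zorn_subset_nonempty {Γ : Set F | ¬ Hilbert imp neg Γ φ}
    (fun c hcs hc hne => ⟨⋃₀ c, fun d => by
      obtain ⟨Γ, hΓ, d⟩ := sUnion hc hne d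
      exact hcs hΓ d, fun s hs => Set.subset_sUnion_of_mem hs⟩) Δ h
  have hΓ : ¬ Hilbert imp neg Γ φ := hmax.prop
  have hins : ∀ ψ, ψ ∉ Γ → Hilbert imp neg (insert ψ Γ) φ := by
    intro ψ hψ
    by_contra hd
    exact hψ (hmax.le_of_ge (y := insert ψ Γ) hd (Set.subset_insert _ _) (Set.mem_insert _ _))
  have hclosed : ∀ ψ, Hilbert imp neg Γ ψ → ψ ∈ Γ := by
    intro ψ hψ
    by_contra hn
    exact hΓ (mp hψ (deduction (hins ψ hn)))
  have hneg : ∀ ψ, neg ψ ∈ Γ ↔ ψ ∉ Γ := by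
    refine fun ψ => ⟨fun hn hp => hΓ (exfalso (prem hp) (prem hn)), fun hp => ?_⟩
    by_contra hn
    exact hΓ (by_cases (hins _ hp) (hins _ hn))
  refine ⟨Γ, hΔ, fun hφ => hΓ (prem hφ), fun ψ θ => ⟨fun hi hp => ?_, fun hi => ?_⟩, hneg⟩
  · exact hclosed _ (mp (prem hp) (prem hi))
  · apply hclosed
    by_cases hp : ψ ∈ Γ
    · exact weaken (prem (hi hp))
    · exact deduction (exfalso hyp (lift (prem ((hneg ψ).2 hp))))

end Hilbert

/-! ## Classical formulas -/

namespace QBF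

theorem holds_top (s : Assignment) : top.Holds s := fun h => h

theorem not_holds_bot (s : Assignment) : ¬ bot.Holds s := fun h => h (holds_top s)

theorem holds_and (α β : QBF) (s : Assignment) :
    (and α β).Holds s ↔ α.Holds s ∧ β.Holds s := by
  simp [and, Holds]

theorem holds_or (α β : QBF) (s : Assignment) :
    (or α β).Holds s ↔ α.Holds s ∨ β.Holds s := by
  simp only [or, Holds]
  tauto

theorem holds_iff (α β : QBF) (s : Assignment) :
    (iff α β).Holds s ↔ (α.Holds s ↔ β.Holds s) := by
  rw [iff, holds_and]
  exact iff_iff_implies_and_implies.symm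

/-- The classical formula `∃ x α`. -/
def ex (x : ℕ) (α : QBF) : QBF := neg (all x (neg α))

theorem holds_ex (x : ℕ) (α : QBF) (s : Assignment) :
    (ex x α).Holds s ↔ ∃ a, α.Holds (Function.update s x a) := by
  simp only [ex, Holds, not_forall, not_not]

/-- The number of quantifiers. -/
def quantifiers : QBF → ℕ
  | var _ => 0
  | neg α => α.quantifiers
  | imp α β => α.quantifiers + β.quantifiers
  | all _ α => α.quantifiers + 1

/-- Axiom `X` trades a quantifier for two substitution instances. These can be longer than the
original formula, so `holds_iff_mem` inducts on the number of quantifiers first and on structure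
second. -/
theorem quantifiers_subst (α γ : QBF) (x : ℕ) (hγ : γ.quantifiers = 0) :
    (α.subst x γ).quantifiers = α.quantifiers := by
  induction α with
  | var y => by_cases h : y = x <;> simp [subst, h, hγ, quantifiers]
  | neg α ih => simp [subst, quantifiers, ih]
  | imp α β ihα ihβ => simp [subst, quantifiers, ihα, ihβ]
  | all y α ih => by_cases h : y = x <;> simp [subst, h, quantifiers, ih]

/-- A complete and consistent set that contains the axioms `X` consists of the formulas that hold
under the assignment it defines. -/
theorem holds_iff_mem {Γ : Set QBF} (hX : ∀ α, AxiomX α → α ∈ Γ)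
    (himp : ∀ α β, imp α β ∈ Γ ↔ (α ∈ Γ → β ∈ Γ)) (hneg : ∀ α, neg α ∈ Γ ↔ α ∉ Γ)
    {s : Assignment} (hs : ∀ x, s x = true ↔ var x ∈ Γ) (n : ℕ) :
    ∀ α : QBF, α.quantifiers = n → (α.Holds s ↔ α ∈ Γ) := by
  induction n using Nat.strong_induction_on with
  | _ n ih =>
    intro α
    induction α generalizing n with
    | var x => exact fun _ => hs x
    | neg α ihα =>
      intro h
      rw [Holds, hneg, ihα n ih h]
    | imp α β ihα ihβ =>
      intro h
      simp only [quantifiers] at h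
      rw [Holds, himp, ihα _ (fun m hm => ih m (by omega)) rfl,
        ihβ _ (fun m hm => ih m (by omega)) rfl]
    | all x α _ =>
      intro h
      simp only [quantifiers] at h
      have hax := hX _ (AxiomX.x x α)
      simp only [iff, and, hneg, himp] at hax
      rw [holds_all_iff, ih α.quantifiers (by omega) _ (quantifiers_subst _ _ _ rfl),
        ih α.quantifiers (by omega) _ (quantifiers_subst _ _ _ rfl)]
      tauto

/-- Strong completeness of `H⁰X`. -/
theorem exists_model {Δ : Set QBF} (hX : ∀ α, AxiomX α → α ∈ Δ) {α : QBF}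
    (h : ¬ Hilbert imp neg Δ α) : ∃ s, (∀ β ∈ Δ, β.Holds s) ∧ ¬ α.Holds s := by
  classical
  obtain ⟨Γ, hΔ, hα, himp, hneg⟩ := Hilbert.exists_complete h
  have key := fun β => holds_iff_mem (s := fun x => decide (var x ∈ Γ))
    (fun γ hγ => hΔ (hX γ hγ)) himp hneg (by simp) _ β rfl
  exact ⟨_, fun β hβ => (key β).2 (hΔ hβ), fun hs => hα ((key α).1 hs)⟩

/-- A strict upper bound of the propositional statements in a formula. -/
def bound : QBF → ℕ
  | var x => x + 1
  | neg α => α.bound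
  | imp α β => max α.bound β.bound
  | all _ α => α.bound

/-- The formula that describes an assignment on the first `n` propositional statements. -/
def describe (s : Assignment) : ℕ → QBF
  | 0 => top
  | n + 1 => and (describe s n) (if s n then var n else neg (var n))

end QBF

/-- Agreement on the first `n` propositional statements. -/
def AgreeOn (n : ℕ) (s t : Assignment) : Prop := ∀ i < n, s i = t i

theorem AgreeOn.symm {n : ℕ} {s t : Assignment} (h : AgreeOn n s t) : AgreeOn n t s :=
  fun i hi => (h i hi).symm

theorem AgreeOn.update {n : ℕ} {s t : Assignment} (h : AgreeOn n s t) (x : ℕ) (a : Bool) :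
    AgreeOn n (Function.update s x a) (Function.update t x a) := by
  intro i hi
  by_cases hx : i = x
  · subst hx
    simp
  · simp [hx, h i hi]

namespace QBF

theorem holds_describe (s t : Assignment) (n : ℕ) :
    (describe s n).Holds t ↔ AgreeOn n s t := by
  induction n with
  | zero => simp [describe, holds_top, AgreeOn]
  | succ n ih =>
    have h : (if s n then var n else neg (var n)).Holds t ↔ s n = t n := by
      cases s n <;> cases ht : t n <;> simp [Holds, ht]
    rw [describe, holds_and, ih, h]
    simp only [AgreeOn, Nat.lt_succ_iff_lt_or_eq]
    exact ⟨fun ⟨h₁, h₂⟩ i hi => hi.elim (h₁ i) fun e => e ▸ h₂,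
      fun h => ⟨fun i hi => h i (.inl hi), h n (.inr rfl)⟩⟩

theorem holds_congr (α : QBF) {n : ℕ} (hn : α.bound ≤ n) {s t : Assignment}
    (h : AgreeOn n s t) : α.Holds s ↔ α.Holds t := by
  induction α generalizing s t with
  | var x => rw [Holds, Holds, h x hn]
  | neg α ih => rw [Holds, Holds, ih hn h]
  | imp α β ihα ihβ =>
    rw [Holds, Holds, ihα (le_trans (le_max_left _ _) hn) h,
      ihβ (le_trans (le_max_right _ _) hn) h]
  | all x α ih => exact forall_congr' fun a => ih hn (h.update x a)

end QBF

/-! ## Formulas depend on finitely many propositional statements -/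

/-- The strict upper bound of the propositional statements that are relevant to a formula. -/
def Form.bound : {k : Bool} → Form k → ℕ
  | _, .flat α => α.bound
  | _, .sneg φ => φ.bound
  | _, .mimp φ ψ => max φ.bound ψ.bound
  | _, .limp φ ψ => max φ.bound ψ.bound
  | _, .shriek _ φ => φ.bound
  | _, .all _ φ => φ.bound

/-- Every assignment in `T` agrees with one in `T'`. -/
def Team.Below (n : ℕ) (T T' : Team) : Prop := ∀ s ∈ T, ∃ t ∈ T', AgreeOn n s t

theorem Team.Below.supplement {n : ℕ} {T T' : Team} {f g : Assignment → Set Bool}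
    (h : ∀ s ∈ T, ∀ a ∈ f s, ∃ t ∈ T', AgreeOn n s t ∧ a ∈ g t) (x : ℕ) :
    Team.Below n (T.supplement f x) (T'.supplement g x) := by
  rintro _ ⟨s, hs, a, ha, rfl⟩
  obtain ⟨t, ht, hst, ha'⟩ := h s hs a ha
  exact ⟨_, ⟨t, ht, a, ha', rfl⟩, hst.update x a⟩

/-- A division of a team carries over to any team that agrees with it. -/
theorem Team.exists_division {n : ℕ} {S U T' : Team} (h : Team.Below n (S ∪ U) T')
    (h' : Team.Below n T' (S ∪ U)) :
    ∃ S' U' : Team, S' ∪ U' = T' ∧ (Team.Below n S S' ∧ Team.Below n S' S) ∧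
      Team.Below n U U' ∧ Team.Below n U' U := by
  refine ⟨{t ∈ T' | ∃ s ∈ S, AgreeOn n t s}, {t ∈ T' | ∃ s ∈ U, AgreeOn n t s}, ?_,
    ⟨?_, fun t ht => ht.2⟩, ?_, fun t ht => ht.2⟩
  · ext t
    constructor
    · rintro (h | h) <;> exact h.1
    · intro ht
      obtain ⟨s, hs | hs, hst⟩ := h' t ht
      · exact .inl ⟨ht, s, hs, hst⟩
      · exact .inr ⟨ht, s, hs, hst⟩
  · intro s hs
    obtain ⟨t, ht, hst⟩ := h s (.inl hs)
    exact ⟨t, ⟨ht, s, hs, hst.symm⟩, hst⟩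
  · intro s hs
    obtain ⟨t, ht, hst⟩ := h s (.inr hs)
    exact ⟨t, ⟨ht, s, hs, hst.symm⟩, hst⟩

theorem Form.Sat.congr {k : Bool} (φ : Form k) {n : ℕ} (hn : φ.bound ≤ n) {T T' : Team}
    (h : Team.Below n T T') (h' : Team.Below n T' T) (hT : φ.Sat T) : φ.Sat T' := by
  induction φ generalizing T T' with
  | flat α =>
    intro s hs
    obtain ⟨t, ht, hst⟩ := h' s hs
    exact (α.holds_congr hn hst).2 (hT t ht)
  | sneg φ ih => exact fun hT' => hT (ih hn h' h hT')
  | mimp φ ψ ihφ ihψ =>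
    exact fun hφ => ihψ (le_trans (le_max_right _ _) hn) h h'
      (hT (ihφ (le_trans (le_max_left _ _) hn) h' h hφ))
  | limp φ ψ ihφ ihψ =>
    rintro S U rfl hS
    obtain ⟨S', U', hT', ⟨hS₁, hS₂⟩, hU₁, hU₂⟩ := Team.exists_division h' h
    exact ihψ (le_trans (le_max_right _ _) hn) hU₂ hU₁
      (hT S' U' hT' (ihφ (le_trans (le_max_left _ _) hn) hS₁ hS₂ hS))
  | shriek x φ ih =>
    intro f hf
    -- The supplementing function is transferred by giving `s` every value that `f` gives to some
    -- member of `T'` agreeing with `s`.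
    refine ih hn ?_ ?_ (hT (fun s => {a | ∃ t ∈ T', AgreeOn n s t ∧ a ∈ f t}) fun s hs => ?_)
    · exact Team.Below.supplement (fun s _ a ha => ha) x
    · refine Team.Below.supplement (fun t ht a ha => ?_) x
      obtain ⟨s, hs, hst⟩ := h' t ht
      exact ⟨s, hs, hst, t, ht, hst.symm, ha⟩
    · obtain ⟨t, ht, hst⟩ := h s hs
      obtain ⟨a, ha⟩ := hf t ht
      exact ⟨a, t, ht, hst, ha⟩
  | all x φ ih =>
    refine ih hn ?_ ?_ hT
    · exact Team.Below.supplement (fun s hs a _ => (h s hs).imp fun t ht => ⟨ht.1, ht.2, trivial⟩) x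
    · exact Team.Below.supplement (fun s hs a _ => (h' s hs).imp fun t ht => ⟨ht.1, ht.2, trivial⟩) x

/-! ## Soundness -/

theorem Team.mem_supplement_of_mem {T : Team} {f : Assignment → Set Bool} {s : Assignment}
    (hs : s ∈ T) {a : Bool} (ha : a ∈ f s) (x : ℕ) :
    Function.update s x a ∈ T.supplement f x := ⟨s, hs, a, ha, rfl⟩

namespace QPTL

theorem sat_conj (φ ψ : QPTL) (T : Team) : (conj φ ψ).Sat T ↔ φ.Sat T ∧ ψ.Sat T := by
  change ¬ (φ.Sat T → ¬ ψ.Sat T) ↔ _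
  tauto

theorem sat_biimp (φ ψ : QPTL) (T : Team) : (φ ⇿ ψ).Sat T ↔ (φ.Sat T ↔ ψ.Sat T) := by
  rw [biimp, sat_conj]
  exact iff_iff_implies_and_implies.symm

theorem sat_tensor (φ ψ : QPTL) (T : Team) :
    (φ ⊗ᵗ ψ).Sat T ↔ ∃ S U : Team, S ∪ U = T ∧ φ.Sat S ∧ ψ.Sat U := by
  change ¬ (∀ S U : Team, S ∪ U = T → φ.Sat S → ¬ ψ.Sat U) ↔ _
  push Not
  rfl

theorem sat_ex (x : ℕ) (φ : QPTL) (T : Team) :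
    (ex x φ).Sat T ↔
      ∃ f : Assignment → Set Bool, (∀ s ∈ T, (f s).Nonempty) ∧ φ.Sat (T.supplement f x) := by
  change ¬ (∀ f : Assignment → Set Bool, (∀ s ∈ T, (f s).Nonempty) →
    ¬ φ.Sat (T.supplement f x)) ↔ _
  push Not
  rfl

theorem sat_flat (α : QBF) (T : Team) : (flat α).Sat T ↔ ∀ s ∈ T, α.Holds s := Iff.rfl

end QPTL

open QPTL

theorem AxiomH.holds {α : QBF} (h : AxiomH α) (s : Assignment) : α.Holds s := by
  cases h <;> simp only [QBF.Holds] <;> tauto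

theorem AxiomX.holds {α : QBF} (h : AxiomX α) (s : Assignment) : α.Holds s := by
  obtain ⟨x, α⟩ := h
  rw [QBF.holds_iff, QBF.holds_and, QBF.holds_all_iff]

theorem AxiomL.sat {φ : QPTL} (h : AxiomL φ) (T : Team) : φ.Sat T := by
  cases h with
  | l1 φ ψ => exact fun h _ => h
  | l2 φ ψ θ => exact fun h h' hφ => h hφ (h' hφ)
  | l3 φ ψ => exact fun h hψ => by_contra fun hφ => h hφ hψ
  | l4 α β => exact fun h h' s hs => h s hs (h' s hs)

theorem AxiomS.sat {φ : QPTL} (h : AxiomS φ) (T : Team) : φ.Sat T := by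
  cases h with
  | flatTensor α β =>
    rw [sat_biimp, sat_tensor]
    simp only [sat_flat, QBF.holds_or]
    constructor
    · rintro ⟨S, U, rfl, hS, hU⟩ s (hs | hs)
      · exact .inl (hS s hs)
      · exact .inr (hU s hs)
    · intro h
      refine ⟨{s ∈ T | α.Holds s}, {s ∈ T | β.Holds s}, ?_, fun s hs => hs.2, fun s hs => hs.2⟩
      ext s
      exact ⟨fun hs => hs.elim And.left And.left,
        fun hs => (h s hs).imp (fun h => ⟨hs, h⟩) fun h => ⟨hs, h⟩⟩
  | flatLimp α φ =>
    rintro h S U rfl _ s hs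
    exact h s (.inr hs)
  | lax φ ψ θ =>
    rintro h h' S U rfl _
    exact h' (S ∪ U) U (by rw [Set.union_assoc, Set.union_self]) h
  | exchange φ ψ θ =>
    rintro h S U rfl hS S' U' rfl hS'
    exact h S' (S ∪ U') (by rw [Set.union_left_comm]) hS' S U' rfl hS
  | contra φ ψ =>
    rintro h S U rfl hS hU
    exact h U S (Set.union_comm _ _) hU hS
  | dis φ ψ θ => exact fun h h' S U hT hS => h S U hT hS (h' S U hT hS)

theorem sat_ex_flat (x : ℕ) (α : QBF) (T : Team) :
    (QPTL.ex x (.flat α)).Sat T ↔ (QPTL.flat (.ex x α)).Sat T := by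
  rw [sat_ex]
  simp only [sat_flat, QBF.holds_ex]
  constructor
  · rintro ⟨f, hf, h⟩ s hs
    obtain ⟨a, ha⟩ := hf s hs
    exact ⟨a, h _ (Team.mem_supplement_of_mem hs ha x)⟩
  · intro h
    refine ⟨fun s => {a | α.Holds (Function.update s x a)}, h, ?_⟩
    rintro _ ⟨s, hs, a, ha, rfl⟩
    exact ha

/-- Laxity matters in both directions: an assignment whose updates fall into both halves is put into
both, and conversely two supplementing functions are merged by taking unions of their values. -/
theorem sat_ex_tensor (x : ℕ) (φ ψ : QPTL) (T : Team) :
    (QPTL.ex x (φ ⊗ᵗ ψ)).Sat T ↔ (QPTL.ex x φ ⊗ᵗ QPTL.ex x ψ).Sat T := by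
  rw [sat_tensor, sat_ex]
  simp only [sat_tensor, sat_ex]
  constructor
  · rintro ⟨f, hf, S, U, hSU, hS, hU⟩
    have hmem : ∀ V : Team, V ⊆ T.supplement f x →
        Team.supplement {s ∈ T | ∃ a ∈ f s, Function.update s x a ∈ V}
          (fun s => {a | a ∈ f s ∧ Function.update s x a ∈ V}) x = V := by
      intro V hV
      ext u
      constructor
      · rintro ⟨s, _, a, ha, rfl⟩
        exact ha.2
      · intro hu
        obtain ⟨s, hs, a, ha, rfl⟩ := hV hu
        exact ⟨s, ⟨hs, a, ha, hu⟩, a, ⟨ha, hu⟩, rfl⟩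
    refine ⟨{s ∈ T | ∃ a ∈ f s, Function.update s x a ∈ S},
      {s ∈ T | ∃ a ∈ f s, Function.update s x a ∈ U}, ?_,
      ⟨fun s => {a | a ∈ f s ∧ Function.update s x a ∈ S}, fun s hs => hs.2, ?_⟩,
      ⟨fun s => {a | a ∈ f s ∧ Function.update s x a ∈ U}, fun s hs => hs.2, ?_⟩⟩
    · ext s
      refine ⟨fun hs => hs.elim And.left And.left, fun hs => ?_⟩
      obtain ⟨a, ha⟩ := hf s hs
      have hu : Function.update s x a ∈ S ∪ U := hSU ▸ Team.mem_supplement_of_mem hs ha x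
      exact hu.imp (fun h => ⟨hs, a, ha, h⟩) fun h => ⟨hs, a, ha, h⟩
    · rwa [hmem S (hSU ▸ Set.subset_union_left)]
    · rwa [hmem U (hSU ▸ Set.subset_union_right)]
  · rintro ⟨S, U, rfl, ⟨f, hf, hS⟩, g, hg, hU⟩
    refine ⟨fun s => {a | (s ∈ S ∧ a ∈ f s) ∨ (s ∈ U ∧ a ∈ g s)}, ?_, _, _, ?_, hS, hU⟩
    · rintro s (hs | hs)
      · exact (hf s hs).imp fun a ha => .inl ⟨hs, ha⟩
      · exact (hg s hs).imp fun a ha => .inr ⟨hs, ha⟩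
    · ext u
      constructor
      · rintro (⟨s, hs, a, ha, rfl⟩ | ⟨s, hs, a, ha, rfl⟩)
        · exact ⟨s, .inl hs, a, .inl ⟨hs, ha⟩, rfl⟩
        · exact ⟨s, .inr hs, a, .inr ⟨hs, ha⟩, rfl⟩
      · rintro ⟨s, _, a, ⟨hs, ha⟩ | ⟨hs, ha⟩, rfl⟩
        · exact .inl ⟨s, hs, a, ha, rfl⟩
        · exact .inr ⟨s, hs, a, ha, rfl⟩

theorem AxiomQ.sat {φ : QPTL} (h : AxiomQ φ) (T : Team) : φ.Sat T := by
  cases h with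
  | linAll x φ =>
    rw [sat_biimp, sat_all]
    exact not_congr (sat_all x φ T).symm
  | flatEx x α =>
    rw [sat_biimp]
    exact sat_ex_flat x α T
  | exTensor x φ ψ =>
    rw [sat_biimp]
    exact sat_ex_tensor x φ ψ T
  | elimAll x α =>
    rintro h f _ _ ⟨s, hs, a, _, rfl⟩
    exact h s hs a
  | introAll x φ =>
    intro h
    exact (sat_all x φ T).2 (h _ fun _ _ => Set.univ_nonempty)
  | disAll x φ ψ =>
    intro h h'
    exact (sat_all x ψ T).2 ((sat_all x _ T).1 h ((sat_all x φ T).1 h'))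
  | disShriek x φ ψ => exact fun h h' f hf => h f hf (h' f hf)

theorem Derives.sound {Φ : Set QPTL} {φ : QPTL} (d : Derives Φ φ) : Entails Φ φ := by
  induction d with
  | premise h => exact fun T hT => hT _ h
  | axH h => exact fun T _ s _ => h.holds s
  | axX h => exact fun T _ s _ => h.holds s
  | axL h => exact fun T _ => h.sat T
  | axS h => exact fun T _ => h.sat T
  | axQ h => exact fun T _ => h.sat T
  | mpImp _ _ ih₁ ih₂ => exact fun T hT s hs => ih₂ T hT s hs (ih₁ T hT s hs)
  | mpMimp _ _ ih₁ ih₂ => exact fun T hT => ih₂ T hT (ih₁ T hT)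
  | nec ψ _ ih => exact fun T _ S U _ _ => ih U (by simp)
  | gen x _ ih => exact fun T _ f _ => ih _ (by simp)

/-! ## Maximal consistent sets -/

theorem Derives.mono {Φ Ψ : Set QPTL} {φ : QPTL} (d : Derives Φ φ) (hsub : Φ ⊆ Ψ) :
    Derives Ψ φ := by
  induction d with
  | premise hφ => exact premise (hsub hφ)
  | axH h => exact axH h
  | axX h => exact axX h
  | axL h => exact axL h
  | axS h => exact axS h
  | axQ h => exact axQ h
  | mpImp _ _ ih₁ ih₂ => exact mpImp (ih₁ hsub) (ih₂ hsub)
  | mpMimp _ _ ih₁ ih₂ => exact mpMimp (ih₁ hsub) (ih₂ hsub)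
  | nec ψ d _ => exact nec ψ d
  | gen x d _ => exact gen x d

/-- A set of formulas that contains the theorems and is closed under modus ponens. -/
structure Theory (Γ : Set QPTL) : Prop where
  thm : ∀ {φ}, Derives ∅ φ → φ ∈ Γ
  mp : ∀ {φ ψ}, φ ⇾ ψ ∈ Γ → φ ∈ Γ → ψ ∈ Γ

/-- Maximal consistent sets of formulas. -/
structure MaxCons (Γ : Set QPTL) : Prop where
  thm : ∀ {φ}, Derives ∅ φ → φ ∈ Γ
  mimp_iff : ∀ {φ ψ}, φ ⇾ ψ ∈ Γ ↔ (φ ∈ Γ → ψ ∈ Γ)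
  sneg_iff : ∀ {φ}, ∼φ ∈ Γ ↔ φ ∉ Γ

/-- Since `nec` and `gen` act on theorems only, their results count as axioms here. Modus ponens is
then the only rule, and the propositional Lindenbaum lemma applies. -/
theorem Theory.of_hilbert {Δ : Set QPTL} (hΔ : Theory Δ) {φ : QPTL}
    (d : Hilbert mimp sneg Δ φ) : φ ∈ Δ := by
  induction d with
  | prem h => exact h
  | a1 => exact hΔ.thm (.axL (.l1 _ _))
  | a2 => exact hΔ.thm (.axL (.l2 _ _ _))
  | a3 => exact hΔ.thm (.axL (.l3 _ _))
  | mp _ _ ih₁ ih₂ => exact hΔ.mp ih₂ ih₁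

theorem Theory.exists_maxCons {Δ : Set QPTL} (hΔ : Theory Δ) {φ : QPTL} (h : φ ∉ Δ) :
    ∃ Γ, MaxCons Γ ∧ Δ ⊆ Γ ∧ φ ∉ Γ := by
  obtain ⟨Γ, hsub, hφ, himp, hneg⟩ :=
    Hilbert.exists_complete (imp := mimp) (neg := sneg) fun d => h (hΔ.of_hilbert d)
  exact ⟨Γ, ⟨fun d => hsub (hΔ.thm d), himp _ _, hneg _⟩, hsub, hφ⟩

theorem theory_derives (Φ : Set QPTL) : Theory {φ | Derives Φ φ} :=
  ⟨fun d => d.mono (Set.empty_subset _), fun h h' => .mpMimp h' h⟩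

/-- The formula `φ` implies `ψ` in all maximal consistent sets. -/
def Implies (φ ψ : QPTL) : Prop := ∀ Γ, MaxCons Γ → φ ∈ Γ → ψ ∈ Γ

/-- This replaces derivations inside the calculus by reasoning about membership in maximal
consistent sets. -/
theorem Implies.derives {φ ψ : QPTL} (h : Implies φ ψ) : Derives ∅ (φ ⇾ ψ) := by
  by_contra hd
  obtain ⟨Γ, hΓ, -, hφ⟩ := (theory_derives ∅).exists_maxCons hd
  exact hφ (hΓ.mimp_iff.2 (h Γ hΓ))

/-- The team of all assignments that satisfy the classical formulas of a set. -/
def teamOf (Γ : Set QPTL) : Team := {s | ∀ α, flat α ∈ Γ → α.Holds s}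

/-! ### Connectives and splits in maximal consistent sets -/

namespace MaxCons

variable {Γ : Set QPTL} (hΓ : MaxCons Γ) {φ φ' ψ ψ' θ : QPTL} {α β γ : QBF} {x : ℕ}
include hΓ

theorem mp_thm (d : Derives ∅ (φ ⇾ ψ)) (h : φ ∈ Γ) : ψ ∈ Γ := hΓ.mimp_iff.1 (hΓ.thm d) h

theorem conj_iff : conj φ ψ ∈ Γ ↔ φ ∈ Γ ∧ ψ ∈ Γ := by
  rw [conj, hΓ.sneg_iff, hΓ.mimp_iff, hΓ.sneg_iff]
  tauto

theorem biimp_iff : φ ⇿ ψ ∈ Γ ↔ (φ ∈ Γ ↔ ψ ∈ Γ) := by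
  rw [biimp, hΓ.conj_iff, hΓ.mimp_iff, hΓ.mimp_iff]
  exact iff_iff_implies_and_implies.symm

theorem iff_of_thm (d : Derives ∅ (φ ⇿ ψ)) : φ ∈ Γ ↔ ψ ∈ Γ := hΓ.biimp_iff.1 (hΓ.thm d)

theorem flat_iff : flat α ∈ Γ ↔ ∀ s ∈ teamOf Γ, α.Holds s := by
  refine ⟨fun h s hs => hs α h, fun h => ?_⟩
  by_contra hα
  have hd : ¬ Hilbert QBF.imp QBF.neg {β | flat β ∈ Γ} α := by
    intro d
    apply hα
    clear h hα
    induction d with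
    | prem h => exact h
    | a1 => exact hΓ.thm (.axH (.a1 _ _))
    | a2 => exact hΓ.thm (.axH (.a2 _ _ _))
    | a3 => exact hΓ.thm (.axH (.a3 _ _))
    | mp _ _ ih₁ ih₂ => exact hΓ.mimp_iff.1 (hΓ.mp_thm (.axL (.l4 _ _)) ih₂) ih₁
  obtain ⟨s, hs, hsα⟩ := QBF.exists_model (fun β hβ => hΓ.thm (.axX hβ)) hd
  exact hsα (h s hs)

theorem flat_or_iff : flat α ⊗ᵗ flat β ∈ Γ ↔ flat (.or α β) ∈ Γ :=
  hΓ.iff_of_thm (.axS (.flatTensor α β))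

theorem not_flat_iff : flat α ∉ Γ ↔ ∃ s ∈ teamOf Γ, ¬ α.Holds s := by
  rw [hΓ.flat_iff]
  push Not
  rfl

theorem flat_conj (h : flat α ∈ Γ) (h' : flat β ∈ Γ) : flat (.and α β) ∈ Γ :=
  hΓ.flat_iff.2 fun s hs => (QBF.holds_and α β s).2 ⟨hs α h, hs β h'⟩

theorem limp_mp (h : φ ⊸ (ψ ⇾ θ) ∈ Γ) (h' : φ ⊸ ψ ∈ Γ) : φ ⊸ θ ∈ Γ :=
  hΓ.mimp_iff.1 (hΓ.mp_thm (.axS (.dis _ _ _)) h) h'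

theorem tensor_iff : φ ⊗ᵗ ψ ∈ Γ ↔ φ ⊸ ∼ψ ∉ Γ := hΓ.sneg_iff

theorem tensor_comm (h : φ ⊗ᵗ ψ ∈ Γ) : ψ ⊗ᵗ φ ∈ Γ := by
  rw [hΓ.tensor_iff] at h ⊢
  exact fun h' => h (hΓ.mp_thm (.axS (.contra _ _)) h')

theorem limp_mono (h : Implies ψ ψ') (hψ : φ ⊸ ψ ∈ Γ) : φ ⊸ ψ' ∈ Γ :=
  hΓ.limp_mp (hΓ.thm (.nec φ h.derives)) hψ

theorem limp_iff : φ ⊸ ψ ∈ Γ ↔ φ ⊗ᵗ ∼ψ ∉ Γ := by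
  rw [hΓ.tensor_iff, not_not]
  constructor <;>
  · refine hΓ.limp_mono fun Δ hΔ => ?_
    rw [hΔ.sneg_iff, hΔ.sneg_iff, not_not]
    exact id

/-- A successor of `Γ` that witnesses the right component of a split. -/
theorem exists_right (h : φ ⊗ᵗ ψ ∈ Γ) :
    ∃ Δ, MaxCons Δ ∧ ψ ∈ Δ ∧ ∀ θ ∈ Δ, φ ⊗ᵗ θ ∈ Γ := by
  have hth : Theory {θ | φ ⊸ θ ∈ Γ} :=
    ⟨fun d => hΓ.thm (.nec φ d), fun h h' => hΓ.limp_mp h h'⟩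
  obtain ⟨Δ, hΔ, hsub, hψ⟩ := hth.exists_maxCons (hΓ.tensor_iff.1 h)
  rw [hΔ.sneg_iff, not_not] at hψ
  exact ⟨Δ, hΔ, hψ, fun θ hθ => hΓ.tensor_iff.2 fun hn => hΔ.sneg_iff.1 (hsub hn) hθ⟩

theorem tensor_mono_right (h : Implies ψ ψ') (hψ : φ ⊗ᵗ ψ ∈ Γ) : φ ⊗ᵗ ψ' ∈ Γ := by
  obtain ⟨Δ, hΔ, hψ, hall⟩ := hΓ.exists_right hψ
  exact hall _ (h Δ hΔ hψ)

theorem tensor_mono_left (h : Implies φ φ') (hφ : φ ⊗ᵗ ψ ∈ Γ) : φ' ⊗ᵗ ψ ∈ Γ :=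
  hΓ.tensor_comm (hΓ.tensor_mono_right h (hΓ.tensor_comm hφ))

theorem limp_anti (h : Implies φ φ') (hφ : φ' ⊸ ψ ∈ Γ) : φ ⊸ ψ ∈ Γ := by
  rw [hΓ.limp_iff] at hφ ⊢
  exact fun h' => hφ (hΓ.tensor_mono_left h h')

/-- The canonical witness of a split. -/
theorem exists_split (h : φ ⊗ᵗ ψ ∈ Γ) :
    ∃ Δ Δ', MaxCons Δ ∧ MaxCons Δ' ∧ φ ∈ Δ ∧ ψ ∈ Δ' ∧
      ∀ θ ∈ Δ, ∀ θ' ∈ Δ', θ ⊗ᵗ θ' ∈ Γ := by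
  obtain ⟨Δ, hΔ, hφ, hall⟩ := hΓ.exists_right (hΓ.tensor_comm h)
  -- The right component must be compatible with all of `Δ` at once. Closure under modus ponens
  -- holds because two formulas of `Δ` can be replaced by their conjunction.
  have hth : Theory {b | ∃ a ∈ Δ, a ⊸ b ∈ Γ} := by
    refine ⟨fun d => ⟨φ, hφ, hΓ.thm (.nec φ d)⟩, ?_⟩
    rintro b c ⟨a, ha, h⟩ ⟨a', ha', h'⟩
    refine ⟨conj a a', hΔ.conj_iff.2 ⟨ha, ha'⟩, hΓ.limp_mp (hΓ.limp_anti ?_ h)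
      (hΓ.limp_anti ?_ h')⟩
    · exact fun Θ hΘ hc => (hΘ.conj_iff.1 hc).1
    · exact fun Θ hΘ hc => (hΘ.conj_iff.1 hc).2
  have hψ : ∼ψ ∉ {b | ∃ a ∈ Δ, a ⊸ b ∈ Γ} := by
    rintro ⟨a, ha, h⟩
    exact hΓ.tensor_iff.1 (hΓ.tensor_comm (hall a ha)) h
  obtain ⟨Δ', hΔ', hsub, hψ'⟩ := hth.exists_maxCons hψ
  rw [hΔ'.sneg_iff, not_not] at hψ'
  refine ⟨Δ, Δ', hΔ, hΔ', hφ, hψ', fun θ hθ θ' hθ' => ?_⟩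
  exact hΓ.tensor_iff.2 fun hn => hΔ'.sneg_iff.1 (hsub ⟨θ, hθ, hn⟩) hθ'

/-- The parts of a split may overlap, so the left part can always be enlarged to the whole team. -/
theorem tensor_lax (hφ : φ ∈ Γ) (h : θ ⊗ᵗ ψ ∈ Γ) : φ ⊗ᵗ ψ ∈ Γ := by
  rw [hΓ.tensor_iff] at h ⊢
  exact fun h' => h (hΓ.mimp_iff.1 (hΓ.mp_thm (.axS (.lax _ _ _)) hφ) h')

theorem tensor_left_comm (h : φ ⊗ᵗ (ψ ⊗ᵗ θ) ∈ Γ) : ψ ⊗ᵗ (φ ⊗ᵗ θ) ∈ Γ := by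
  have key : ∀ {φ ψ}, φ ⊗ᵗ (ψ ⊗ᵗ θ) ∈ Γ ↔ φ ⊸ (ψ ⊸ ∼θ) ∉ Γ := by
    intro φ ψ
    rw [hΓ.tensor_iff, not_iff_not]
    constructor <;>
    · refine hΓ.limp_mono fun Δ hΔ => ?_
      rw [hΔ.sneg_iff, hΔ.tensor_iff, not_not]
      exact id
  rw [key] at h ⊢
  exact fun h' => h (hΓ.mp_thm (.axS (.exchange _ _ _)) h')

theorem tensor_right_comm (h : (φ ⊗ᵗ ψ) ⊗ᵗ θ ∈ Γ) : (φ ⊗ᵗ θ) ⊗ᵗ ψ ∈ Γ := by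
  have h₁ := hΓ.tensor_mono_right (fun Δ hΔ => hΔ.tensor_comm) (hΓ.tensor_comm h)
  exact hΓ.tensor_mono_left (fun Δ hΔ => hΔ.tensor_comm) (hΓ.tensor_comm (hΓ.tensor_left_comm h₁))

/-- Classical formulas carry over to the right component of a split. -/
theorem flat_mem_right (hα : flat α ∈ Γ) (h : φ ⊗ᵗ ψ ∈ Γ) (hψ : Implies ψ ∼(flat α)) :
    False := by
  have h₁ := hΓ.mp_thm (.axS (.flatLimp α φ)) hα
  exact hΓ.limp_iff.1 h₁ (hΓ.tensor_mono_right hψ h)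

/-- Both parts inherit the classical formulas of `Γ`, which gives one inclusion. If `s` lay in
neither part, it would falsify some `α ∈ Δ` and `β ∈ Δ'`, although `α ∨ β` belongs to `Γ`. -/
theorem teamOf_eq_union {Δ Δ' : Set QPTL} (hΔ : MaxCons Δ) (hΔ' : MaxCons Δ')
    (h : ∀ θ ∈ Δ, ∀ θ' ∈ Δ', θ ⊗ᵗ θ' ∈ Γ) : teamOf Δ ∪ teamOf Δ' = teamOf Γ := by
  have htop : ∀ {Θ}, MaxCons Θ → flat .top ∈ Θ :=
    fun hΘ => hΘ.flat_iff.2 fun s _ => QBF.holds_top s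
  ext s
  constructor
  · rintro (hs | hs) α hα
    · refine hs α (by_contra fun hn => ?_)
      exact hΓ.flat_mem_right hα (hΓ.tensor_comm (h _ (hΔ.sneg_iff.2 hn) _ (htop hΔ')))
        fun _ _ => id
    · refine hs α (by_contra fun hn => ?_)
      exact hΓ.flat_mem_right hα (h _ (htop hΔ) _ (hΔ'.sneg_iff.2 hn)) fun _ _ => id
  · intro hs
    by_contra hn
    simp only [Set.mem_union, not_or, teamOf, Set.mem_ofPred_eq, not_forall] at hn
    obtain ⟨⟨α, hα, hsα⟩, β, hβ, hsβ⟩ := hn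
    have := hs _ (hΓ.flat_or_iff.1 (h _ hα _ hβ))
    rw [QBF.holds_or] at this
    exact this.elim hsα hsβ

/-! ## Quantifiers in maximal consistent sets -/

theorem ex_iff : ex x φ ∈ Γ ↔ shriek x ∼φ ∉ Γ := hΓ.sneg_iff

theorem theory_shriek (x : ℕ) : Theory {θ | shriek x θ ∈ Γ} :=
  ⟨fun d => hΓ.thm (.gen x d),
    fun h h' => hΓ.mimp_iff.1 (hΓ.mp_thm (.axQ (.disShriek x _ _)) h) h'⟩

theorem shriek_mono (h : Implies φ ψ) (hφ : shriek x φ ∈ Γ) : shriek x ψ ∈ Γ :=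
  (hΓ.theory_shriek x).mp ((hΓ.theory_shriek x).thm h.derives) hφ

theorem shriek_iff : shriek x φ ∈ Γ ↔ ex x ∼φ ∉ Γ := by
  rw [hΓ.ex_iff, not_not]
  constructor <;>
  · refine hΓ.shriek_mono fun Δ hΔ => ?_
    rw [hΔ.sneg_iff, hΔ.sneg_iff, not_not]
    exact id

/-- The canonical witness of an existential quantifier. -/
theorem exists_ex (h : ex x φ ∈ Γ) :
    ∃ Δ, MaxCons Δ ∧ φ ∈ Δ ∧ (∀ θ, shriek x θ ∈ Γ → θ ∈ Δ) ∧ ∀ θ ∈ Δ, ex x θ ∈ Γ := by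
  obtain ⟨Δ, hΔ, hsub, hφ⟩ := (hΓ.theory_shriek x).exists_maxCons (hΓ.ex_iff.1 h)
  rw [hΔ.sneg_iff, not_not] at hφ
  exact ⟨Δ, hΔ, hφ, fun θ hθ => hsub hθ,
    fun θ hθ => hΓ.ex_iff.2 fun hn => hΔ.sneg_iff.1 (hsub hn) hθ⟩

theorem ex_mono (h : Implies φ ψ) (hφ : ex x φ ∈ Γ) : ex x ψ ∈ Γ := by
  obtain ⟨Δ, hΔ, hφ, -, hall⟩ := hΓ.exists_ex hφ
  exact hall _ (h Δ hΔ hφ)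

theorem ex_flat_iff : ex x (flat α) ∈ Γ ↔ flat (.ex x α) ∈ Γ :=
  hΓ.iff_of_thm (.axQ (.flatEx x α))

theorem ex_tensor_iff : ex x (φ ⊗ᵗ ψ) ∈ Γ ↔ ex x φ ⊗ᵗ ex x ψ ∈ Γ :=
  hΓ.iff_of_thm (.axQ (.exTensor x φ ψ))

theorem flat_all_ex (h : flat α ∈ Γ) : flat (.all x (.ex x α)) ∈ Γ := by
  refine hΓ.flat_iff.2 fun s hs a => (QBF.holds_ex _ _ _).2 ⟨s x, ?_⟩
  simpa using hs α h

/-- If `∃ x α ∈ Δ` for all `α ∈ Γ`, then `teamOf Δ` lies in the duplicating team. -/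
theorem exists_update_mem {Δ : Set QPTL} (h : ∀ α, flat α ∈ Γ → flat (.ex x α) ∈ Δ)
    {u : Assignment} (hu : u ∈ teamOf Δ) : ∃ a, Function.update u x a ∈ teamOf Γ := by
  by_contra hn
  simp only [teamOf, Set.mem_ofPred_eq, not_exists, not_forall] at hn
  -- Each of the two values of `x` is excluded by one classical formula of `Γ`; their conjunction is
  -- still in `Γ`, but `u` falsifies its existential closure over `x`.
  choose α hα hα' using hn
  have := hu _ (h _ (hΓ.flat_conj (hα true) (hα false)))
  obtain ⟨a, ha⟩ := (QBF.holds_ex _ _ _).1 this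
  rw [QBF.holds_and] at ha
  cases a
  · exact hα' _ ha.2
  · exact hα' _ ha.1

theorem teamOf_eq_supplement {Δ : Set QPTL} (hΔ : MaxCons Δ)
    (h : ∀ θ, shriek x θ ∈ Γ → θ ∈ Δ) (h' : ∀ θ ∈ Δ, ex x θ ∈ Γ) :
    ∃ f : Assignment → Set Bool, (∀ s ∈ teamOf Γ, (f s).Nonempty) ∧
      (teamOf Γ).supplement f x = teamOf Δ := by
  -- The largest candidate for `f` allows every value that leads into `teamOf Δ`. Non-emptiness
  -- comes from `∃ x θ ∈ Γ` for `θ ∈ Δ`; that every member of `teamOf Δ` is reached comes from `∀ x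
  -- ∃ x α`, which passes from `Γ` to `Δ`.
  refine ⟨fun s => {a | Function.update s x a ∈ teamOf Δ}, fun s hs => ?_, ?_⟩
  · exact hΔ.exists_update_mem (fun α hα => hΓ.ex_flat_iff.1 (h' _ hα)) hs
  · ext u
    constructor
    · rintro ⟨s, _, a, ha, rfl⟩
      exact ha
    · intro hu
      obtain ⟨a, ha⟩ := hΓ.exists_update_mem (x := x) (fun α hα =>
        h _ (hΓ.mp_thm (.axQ (.elimAll x _)) (hΓ.flat_all_ex hα))) hu
      exact ⟨_, ha, u x, by simpa using hu, by simp⟩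

/-- The maximal consistent set of the duplicating team. -/
theorem all_maxCons (x : ℕ) : MaxCons {θ | QPTL.all x θ ∈ Γ} := by
  have hneg : ∀ {φ}, QPTL.all x ∼φ ∈ Γ ↔ QPTL.all x φ ∉ Γ :=
    fun {φ} => (hΓ.iff_of_thm (.axQ (.linAll x φ))).trans hΓ.sneg_iff
  have hthm : ∀ {φ}, Derives ∅ φ → QPTL.all x φ ∈ Γ :=
    fun d => hΓ.mp_thm (.axQ (.introAll x _)) (hΓ.thm (.gen x d))
  have hmp : ∀ {φ ψ}, QPTL.all x (φ ⇾ ψ) ∈ Γ → QPTL.all x φ ∈ Γ → QPTL.all x ψ ∈ Γ :=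
    fun h => hΓ.mimp_iff.1 (hΓ.mp_thm (.axQ (.disAll x _ _)) h)
  refine ⟨hthm, fun {φ ψ} => ⟨hmp, fun h => ?_⟩, hneg⟩
  by_cases hφ : QPTL.all x φ ∈ Γ
  · exact hmp (hthm (.axL (.l1 _ _))) (h hφ)
  · refine hmp (hthm (Implies.derives fun Δ hΔ hn => ?_)) (hneg.2 hφ)
    exact hΔ.mimp_iff.2 fun h' => absurd h' (hΔ.sneg_iff.1 hn)

theorem teamOf_all (x : ℕ) : teamOf {θ | QPTL.all x θ ∈ Γ} = (teamOf Γ).duplicate x := by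
  ext u
  constructor
  · intro hu
    obtain ⟨a, ha⟩ := hΓ.exists_update_mem (x := x)
      (fun α hα => (hΓ.flat_all_ex hα : QPTL.all x (flat (.ex x α)) ∈ Γ)) hu
    exact ⟨_, ha, u x, trivial, by simp⟩
  · rintro ⟨s, hs, a, -, rfl⟩ α hα
    exact hs (.all x α) hα a

end MaxCons

/-! ## Basic formulas -/

/-- The formula `α ∧ ∼β₁ ∧ ⋯ ∧ ∼βₙ` with classical `α, β₁, …, βₙ`. -/
def basic (α : QBF) : List QBF → QPTL
  | [] => flat α
  | β :: l => conj ∼(flat β) (basic α l)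

namespace MaxCons

variable {Γ : Set QPTL} (hΓ : MaxCons Γ) {χ : QPTL} {α β : QBF} {l : List QBF} {x : ℕ}
include hΓ

theorem basic_iff : basic α l ∈ Γ ↔ flat α ∈ Γ ∧ ∀ β ∈ l, flat β ∉ Γ := by
  induction l with
  | nil => simp [basic]
  | cons β l ih =>
    rw [basic, hΓ.conj_iff, hΓ.sneg_iff, ih, List.forall_mem_cons]
    tauto

theorem basic_singleton_iff : basic α [β] ∈ Γ ↔ flat α ∈ Γ ∧ flat β ∉ Γ := by
  simp [hΓ.basic_iff]

/-- Split the team by `¬α ∨ α`. The right part cannot satisfy `β`, since otherwise `¬α ∨ β` would be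
in `Γ`, against the given assignment. -/
theorem neg_tensor_basic (h : ∃ s ∈ teamOf Γ, α.Holds s ∧ ¬ β.Holds s) :
    flat (.neg α) ⊗ᵗ basic α [β] ∈ Γ := by
  have hor : flat (.neg α) ⊗ᵗ flat α ∈ Γ := by
    refine hΓ.flat_or_iff.2 (hΓ.flat_iff.2 fun s _ => (QBF.holds_or _ _ s).2 ?_)
    exact (em (α.Holds s)).symm
  obtain ⟨Δ, hΔ, hα, hall⟩ := hΓ.exists_right hor
  refine hall _ (hΔ.basic_singleton_iff.2 ⟨hα, fun hβ => ?_⟩)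
  obtain ⟨s, hs, hsα, hsβ⟩ := h
  have := hs _ (hΓ.flat_or_iff.1 (hall _ hβ))
  rw [QBF.holds_or] at this
  exact this.elim (fun h => h hsα) hsβ

theorem basic_cons_of_tensor (h : basic α l ⊗ᵗ basic α [β] ∈ Γ) : basic α (β :: l) ∈ Γ := by
  refine hΓ.basic_iff.2 ⟨?_, List.forall_mem_cons.2 ⟨fun hβ => ?_, fun γ hγ hmem => ?_⟩⟩
  · have h₁ : flat α ⊗ᵗ flat α ∈ Γ :=
      hΓ.tensor_mono_left (fun Δ hΔ hb => (hΔ.basic_iff.1 hb).1)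
        (hΓ.tensor_mono_right (fun Δ hΔ hb => (hΔ.basic_iff.1 hb).1) h)
    refine hΓ.flat_iff.2 fun s hs => ?_
    simpa [QBF.holds_or] using hs _ (hΓ.flat_or_iff.1 h₁)
  · exact hΓ.flat_mem_right hβ h fun Δ hΔ hb => hΔ.sneg_iff.2 (hΔ.basic_singleton_iff.1 hb).2
  · exact hΓ.flat_mem_right hmem (hΓ.tensor_comm h)
      fun Δ hΔ hb => hΔ.sneg_iff.2 ((hΔ.basic_iff.1 hb).2 γ hγ)

/-- Each witness provides a subteam satisfying `α ∧ ∼β`. By laxity the rest of that split can be the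
whole team, which is already divided into `basic α l` and `χ`; regrouping merges the new subteam
into the first part. -/
theorem basic_tensor (h : flat α ⊗ᵗ χ ∈ Γ)
    (hl : ∀ β ∈ l, ∃ s ∈ teamOf Γ, α.Holds s ∧ ¬ β.Holds s) : basic α l ⊗ᵗ χ ∈ Γ := by
  induction l with
  | nil => exact h
  | cons β l ih =>
    rw [List.forall_mem_cons] at hl
    exact hΓ.tensor_mono_left (fun Δ hΔ => hΔ.basic_cons_of_tensor)
      (hΓ.tensor_right_comm (hΓ.tensor_lax (ih hl.2) (hΓ.neg_tensor_basic hl.1)))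

theorem not_flat_bot_iff : flat .bot ∉ Γ ↔ (teamOf Γ).Nonempty := by
  rw [hΓ.not_flat_iff]
  exact ⟨fun ⟨s, hs, _⟩ => ⟨s, hs⟩, fun ⟨s, hs⟩ => ⟨s, hs, QBF.not_holds_bot s⟩⟩

/-- A supplement of a non-empty team is non-empty, so if all its members satisfy `¬β`, then it
satisfies `∼β`. -/
theorem ex_basic_singleton (hne : (teamOf Γ).Nonempty)
    (h : flat (.ex x (.and α (.neg β))) ∈ Γ) : ex x (basic α [β]) ∈ Γ := by
  obtain ⟨Δ, hΔ, hmem, -, hall⟩ := hΓ.exists_ex (hΓ.ex_flat_iff.2 h)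
  have hneΔ : (teamOf Δ).Nonempty := by
    rw [← hΔ.not_flat_bot_iff]
    intro hbot
    obtain ⟨s, hs⟩ := hne
    obtain ⟨a, ha⟩ := (QBF.holds_ex _ _ _).1 (hs _ (hΓ.ex_flat_iff.1 (hall _ hbot)))
    exact QBF.not_holds_bot _ ha
  have hflat := fun s hs => (QBF.holds_and α (.neg β) s).1 (hΔ.flat_iff.1 hmem s hs)
  obtain ⟨s, hs⟩ := hneΔ
  exact hall _ (hΔ.basic_singleton_iff.2
    ⟨hΔ.flat_iff.2 fun s hs => (hflat s hs).1, hΔ.not_flat_iff.2 ⟨s, hs, (hflat s hs).2⟩⟩)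

theorem ex_basic (h : flat (.ex x α) ∈ Γ)
    (hl : ∀ β ∈ l, ∃ s ∈ teamOf Γ, (QBF.ex x (.and α (.neg β))).Holds s) :
    ex x (basic α l) ∈ Γ := by
  induction l with
  | nil => exact hΓ.ex_flat_iff.2 h
  | cons β l ih =>
    rw [List.forall_mem_cons] at hl
    obtain ⟨⟨s, hs, hsβ⟩, hl⟩ := hl
    -- Taking `⊥` as the refuted formula makes the right component a non-empty subteam on which `∃ x
    -- (α ∧ ¬β)` holds. `∃ x` distributes over `⊗ᵗ`, so this subteam's supplement can be joined to
    -- that of the whole team.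
    have h₁ := hΓ.neg_tensor_basic ⟨s, hs, hsβ, QBF.not_holds_bot s⟩
    have h₂ := hΓ.tensor_mono_right (ψ' := ex x (basic α [β])) (fun Δ hΔ hb => by
      obtain ⟨hα, hbot⟩ := hΔ.basic_singleton_iff.1 hb
      exact hΔ.ex_basic_singleton (hΔ.not_flat_bot_iff.1 hbot) hα) h₁
    exact hΓ.ex_mono (fun Δ hΔ => hΔ.basic_cons_of_tensor)
      (hΓ.ex_tensor_iff.2 (hΓ.tensor_lax (ih hl) h₂))

end MaxCons

/-- The formulas that follow from a basic formula which is true in the team `S`. -/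
def basicTheory (S : Team) : Set QPTL :=
  {φ | ∃ α l, (flat α).Sat S ∧ (∀ β ∈ l, ¬ (flat β).Sat S) ∧ Implies (basic α l) φ}

theorem theory_basicTheory (S : Team) : Theory (basicTheory S) := by
  constructor
  · exact fun d => ⟨.top, [], fun s _ => QBF.holds_top s, by simp, fun Γ hΓ _ => hΓ.thm d⟩
  · rintro φ ψ ⟨α, l, hα, hl, h⟩ ⟨α', l', hα', hl', h'⟩
    refine ⟨.and α α', l ++ l', fun s hs => (QBF.holds_and _ _ _).2 ⟨hα s hs, hα' s hs⟩,
      fun β hβ => (List.mem_append.1 hβ).elim (hl β) (hl' β), fun Γ hΓ hb => ?_⟩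
    obtain ⟨hb, hbl⟩ := hΓ.basic_iff.1 hb
    have hand := fun s hs => (QBF.holds_and α α' s).1 (hΓ.flat_iff.1 hb s hs)
    refine hΓ.mimp_iff.1 (h Γ hΓ (hΓ.basic_iff.2 ⟨?_, ?_⟩)) (h' Γ hΓ (hΓ.basic_iff.2 ⟨?_, ?_⟩))
    · exact hΓ.flat_iff.2 fun s hs => (hand s hs).1
    · exact fun β hβ => hbl β (List.mem_append_left _ hβ)
    · exact hΓ.flat_iff.2 fun s hs => (hand s hs).2
    · exact fun β hβ => hbl β (List.mem_append_right _ hβ)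

theorem flat_mem_basicTheory {S : Team} {α : QBF} (h : (flat α).Sat S) :
    flat α ∈ basicTheory S :=
  ⟨α, [], h, by simp, fun _ _ => id⟩

theorem sneg_flat_mem_basicTheory {S : Team} {α : QBF} (h : ¬ (flat α).Sat S) :
    ∼(flat α) ∈ basicTheory S :=
  ⟨.top, [α], fun s _ => QBF.holds_top s, by simpa using h,
    fun _ hΓ hb => hΓ.sneg_iff.2 (hΓ.basic_singleton_iff.1 hb).2⟩

/-- An assignment of `teamOf Γ` that disagreed with all of `S` on the first `n` statements would be
excluded by the negation of its description. Conversely `S ⊆ teamOf Γ`, because any classical `α`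
failing in `S` has `∼α` in `Γ`. -/
theorem MaxCons.teamOf_below {Γ : Set QPTL} (hΓ : MaxCons Γ) {S : Team} (h : basicTheory S ⊆ Γ)
    (n : ℕ) : Team.Below n (teamOf Γ) S ∧ Team.Below n S (teamOf Γ) := by
  constructor
  · intro s hs
    by_contra hn
    have hmem : flat (.neg (QBF.describe s n)) ∈ Γ :=
      h (flat_mem_basicTheory fun t ht ht' => hn ⟨t, ht, (QBF.holds_describe s t n).1 ht'⟩)
    exact hs _ hmem ((QBF.holds_describe s s n).2 fun _ _ => rfl)
  · refine fun s hs => ⟨s, fun α hα => ?_, fun _ _ => rfl⟩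
    by_contra hsα
    exact hΓ.sneg_iff.1 (h (sneg_flat_mem_basicTheory fun hS => hsα ((sat_flat α S).1 hS s hs))) hα

/-! ## The truth lemma and completeness -/

/-- Every maximal consistent extension of `basicTheory S` has a team indistinguishable from `S` up
to `φ.bound`, hence contains `φ` by the induction hypothesis; so `φ` lies in that theory itself. -/
theorem mem_basicTheory_of_sat {k : Bool} {φ : Form k}
    (ih : ∀ Γ, MaxCons Γ → ((⟨k, φ⟩ : QPTL) ∈ Γ ↔ φ.Sat (teamOf Γ))) {S : Team} (hS : φ.Sat S) :
    (⟨k, φ⟩ : QPTL) ∈ basicTheory S := by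
  by_contra hn
  obtain ⟨Γ, hΓ, hsub, hφ⟩ := (theory_basicTheory S).exists_maxCons hn
  obtain ⟨h₁, h₂⟩ := hΓ.teamOf_below hsub φ.bound
  exact hφ ((ih Γ hΓ).2 (Form.Sat.congr φ le_rfl h₂ h₁ hS))

theorem mem_iff_sat {k : Bool} (φ : Form k) :
    ∀ Γ, MaxCons Γ → ((⟨k, φ⟩ : QPTL) ∈ Γ ↔ φ.Sat (teamOf Γ)) := by
  induction φ with
  | flat α => exact fun Γ hΓ => hΓ.flat_iff
  | @sneg k φ ih => exact fun Γ hΓ => hΓ.sneg_iff.trans (not_congr (ih Γ hΓ))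
  | mimp φ ψ ihφ ihψ => exact fun Γ hΓ => hΓ.mimp_iff.trans (imp_congr (ihφ Γ hΓ) (ihψ Γ hΓ))
  | @limp k l φ ψ ihφ ihψ =>
    intro Γ hΓ
    refine (hΓ.limp_iff (φ := ⟨k, φ⟩) (ψ := ⟨l, ψ⟩)).trans ⟨fun h S U hSU hS => ?_, fun h ht => ?_⟩
    · by_contra hU
      have ihψ' : ∀ Γ, MaxCons Γ →
          ((⟨false, .sneg ψ⟩ : QPTL) ∈ Γ ↔ (Form.sneg ψ).Sat (teamOf Γ)) :=
        fun Γ hΓ => hΓ.sneg_iff.trans (not_congr (ihψ Γ hΓ))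
      -- `S` and `U` are arbitrary, so each is replaced by one basic formula true in it; the split
      -- of these two formulas is then shown to lie in `Γ`.
      obtain ⟨α, l, hα, hl, himp⟩ := mem_basicTheory_of_sat ihφ hS
      obtain ⟨γ, l', hγ, hl', himp'⟩ := mem_basicTheory_of_sat ihψ' (S := U) hU
      apply h
      have hor : flat α ⊗ᵗ flat γ ∈ Γ := by
        refine hΓ.flat_or_iff.2 (hΓ.flat_iff.2 fun s hs => (QBF.holds_or _ _ s).2 ?_)
        rw [← hSU] at hs
        exact hs.imp (hα s) (hγ s)
      have hwit : ∀ {V : Team}, V ⊆ teamOf Γ → ∀ {δ β : QBF}, (flat δ).Sat V →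
          ¬ (flat β).Sat V → ∃ s ∈ teamOf Γ, δ.Holds s ∧ ¬ β.Holds s := by
        intro V hV δ β hδ hβ
        rw [sat_flat] at hβ
        push Not at hβ
        obtain ⟨s, hs, hsβ⟩ := hβ
        exact ⟨s, hV hs, hδ s hs, hsβ⟩
      have h₁ := hΓ.basic_tensor hor
        fun β hβ => hwit (hSU ▸ Set.subset_union_left) hα (hl β hβ)
      have h₂ := hΓ.basic_tensor (hΓ.tensor_comm h₁)
        fun β hβ => hwit (hSU ▸ Set.subset_union_right) hγ (hl' β hβ)
      exact hΓ.tensor_mono_left himp (hΓ.tensor_mono_right himp' (hΓ.tensor_comm h₂))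
    · obtain ⟨Δ, Δ', hΔ, hΔ', hφ, hψ, hall⟩ := hΓ.exists_split ht
      exact hΔ'.sneg_iff.1 hψ ((ihψ Δ' hΔ').2
        (h _ _ (hΓ.teamOf_eq_union hΔ hΔ' hall) ((ihφ Δ hΔ).1 hφ)))
  | @shriek k x φ ih =>
    intro Γ hΓ
    refine (hΓ.shriek_iff (φ := ⟨k, φ⟩)).trans ⟨fun h f hf => ?_, fun h ht => ?_⟩
    · by_contra hφ
      have ih' : ∀ Γ, MaxCons Γ →
          ((⟨false, .sneg φ⟩ : QPTL) ∈ Γ ↔ (Form.sneg φ).Sat (teamOf Γ)) :=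
        fun Γ hΓ => hΓ.sneg_iff.trans (not_congr (ih Γ hΓ))
      obtain ⟨α, l, hα, hl, himp⟩ := mem_basicTheory_of_sat ih' hφ
      refine h (hΓ.ex_mono himp (hΓ.ex_basic ?_ fun β hβ => ?_))
      · refine hΓ.flat_iff.2 fun s hs => (QBF.holds_ex _ _ _).2 ?_
        exact (hf s hs).imp fun a ha => hα _ (Team.mem_supplement_of_mem hs ha x)
      · have hβ' := hl β hβ
        rw [sat_flat] at hβ'
        push Not at hβ'
        obtain ⟨_, ⟨s, hs, a, ha, rfl⟩, hsβ⟩ := hβ'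
        refine ⟨s, hs, (QBF.holds_ex _ _ _).2 ⟨a, (QBF.holds_and _ _ _).2 ⟨?_, hsβ⟩⟩⟩
        exact hα _ (Team.mem_supplement_of_mem hs ha x)
    · obtain ⟨Δ, hΔ, hφ, hsub, hall⟩ := hΓ.exists_ex ht
      obtain ⟨f, hf, heq⟩ := hΓ.teamOf_eq_supplement hΔ hsub hall
      exact hΔ.sneg_iff.1 hφ ((ih Δ hΔ).2 (heq ▸ h f hf))
  | all x φ ih =>
    -- No basic formulas are needed here: the duplicating team is itself the team of a maximal
    -- consistent set.
    intro Γ hΓ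
    have h := ih _ (hΓ.all_maxCons x)
    rw [hΓ.teamOf_all] at h
    exact h

theorem Entails.derives {Φ : Set QPTL} {φ : QPTL} (h : Entails Φ φ) : Derives Φ φ := by
  by_contra hd
  obtain ⟨Γ, hΓ, hsub, hφ⟩ := (theory_derives Φ).exists_maxCons hd
  exact hφ ((mem_iff_sat φ.2 Γ hΓ).2
    (h _ fun ψ hψ => (mem_iff_sat ψ.2 Γ hΓ).1 (hsub (Derives.premise hψ))))

end TeamLogic

theorem mainTheorem5 :
    (∀ (Φ : Set TeamLogic.QPTL) (φ : TeamLogic.QPTL),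
      TeamLogic.Derives Φ φ → TeamLogic.Entails Φ φ) ∧
    (∀ (Φ : Set TeamLogic.QPTL) (φ : TeamLogic.QPTL),
      TeamLogic.Entails Φ φ → TeamLogic.Derives Φ φ) :=
  ⟨fun _ _ => TeamLogic.Derives.sound, fun _ _ => TeamLogic.Entails.derives⟩
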